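/- Fix an integer $k\ge 2$ and real constants $\alpha>1/k$ and $r>0$ with $k\,e^{-\alpha/r}\ge 1$, and put $p_{cr}=1-e^{-\alpha/r}$. Let $0\le p\le 1$. For every $n$ let $d_n$, $t_n$, $q_n$ be nonnegative integers obtained by rounding, each up or down to an adjacent integer in an arbitrary way, the numbers $n^{\alpha}$, $r\,n\ln n$ and $p\,d_n^{\,k}$ respectively. A random instance of Model RB with $n\ge k$ variables, each having a domain of $d_n$ values, consists of $t_n$ random constraints chosen independently, with repetition allowed. Each constraint is formed by choosing $k$ distinct variables out of the $n$ uniformly at random and then choosing uniformly at random, without repetition, $q_n$ of the $d_n^{\,k}$ tuples of values of these variables as incompatible; the other $d_n^{\,k}-q_n$ tuples are compatible. The instance is satisfiable if there is an assignment of a value to each variable that gives a compatible tuple on every constraint. Let $\Pr(\mathrm{Sat})$ be the probability that the random instance is satisfiable. Then $$\lim_{n\to\infty}\Pr(\mathrm{Sat})=1\ \text{ when } p<p_{cr},\qquad \lim_{n\to\infty}\Pr(\mathrm{Sat})=0\ \text{ when } p>p_{cr}.$$ -/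

import Mathlib

open Filter Topology

namespace ModelRB

/-- A `k`-ary constraint on the variables `Fin n`, each with domain `Fin d`: a scope, i.e. a set of
`k` distinct variables, and a set of exactly `q` incompatible tuples of values. The `j`-th entry of
a tuple is the value of the `j`-th variable of the scope, in increasing order of the variables. -/
abbrev Constraint (n k d q : ℕ) : Type :=
  {S : Finset (Fin n) // S.card = k} × {Q : Finset (Fin k → Fin d) // Q.card = q}

/-- The tuple of values that the assignment `σ` gives to the variables of the scope of `C`. -/
def Constraint.tuple {n k d q : ℕ} (C : Constraint n k d q) (σ : Fin n → Fin d) : Fin k → Fin d :=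
  fun j => σ (C.1.1.orderEmbOfFin C.1.2 j)

/-- The assignment `σ` satisfies `C` if its tuple of values on the scope of `C` is compatible. -/
def Constraint.SatisfiedBy {n k d q : ℕ} (C : Constraint n k d q) (σ : Fin n → Fin d) : Prop :=
  C.tuple σ ∉ C.2.1

/-- An instance: a sequence of `t` constraints, repetitions allowed. -/
abbrev Instance (n k d t q : ℕ) : Type := Fin t → Constraint n k d q

/-- An instance is satisfiable if some assignment satisfies all of its constraints. -/
def Instance.Satisfiable {n k d t q : ℕ} (I : Instance n k d t q) : Prop :=
  ∃ σ : Fin n → Fin d, ∀ i : Fin t, (I i).SatisfiedBy σ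

/-- The probability that a random instance is satisfiable. The `t` constraints are independent;
each has a uniformly random scope, and, given the scope, a uniformly random set of `q` incompatible
tuples. As the number of such sets does not depend on the scope, this is the uniform distribution
on the finite set of all instances. -/
noncomputable def prSat (n k d t q : ℕ) : ℝ :=
  (Nat.card {I : Instance n k d t q // I.Satisfiable} : ℝ) / (Nat.card (Instance n k d t q) : ℝ)

/-- `m` is the real number `x` rounded to an adjacent integer, down or up
(`m = x` if `x` is an integer). -/
def IsRounding (m : ℕ) (x : ℝ) : Prop := |(m : ℝ) - x| < 1

end ModelRB

/-! Let `N` be the number of solutions. Above the threshold `E N` tends to 0, which bounds the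
probability of satisfiability (`prSat_le`). Below it, Cauchy-Schwarz gives `Pr(Sat) ≥ (E N)² / E
N²`, and the inverse ratio is at most the average of `(1 + c x^k)^t` over pairs of assignments, `x`
being the fraction of variables on which they agree (`le_prSat_mul_sum`).

This average tends to 1 by a split on `x` (`overlap_weight_le`). For `x ≤ n^(-β)` with `1/k < β <
min α 1` the weight is `1 + o(1)`. For larger `x` up to a small `ε`, `x^k ≤ ε x` suffices. Beyond
`ε`, `k e^(-α/r) ≥ 1` permits `1 + c ≤ k`, hence `log (1 + c x^k) ≤ x log (1 + c)`
(`log_one_add_mul_pow_le`), and `r log (1 + c) < α` closes the estimate. Each bound is exponential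
in the number of agreements, so its sum over pairs factorises over the variables
(`sum_pow_card_agree`). -/

namespace ModelRB

/-! ### Counting forbidden sets and scopes by binomial coefficients. -/

open Classical in
theorem card_filter_disjoint {T : Type*} [Fintype T] (q : ℕ) (B : Finset T) :
    (Finset.univ.filter
      (fun Q : {Q : Finset T // Q.card = q} => Disjoint B Q.1)).card
      = (Fintype.card T - B.card).choose q := by
  rw [← Finset.card_compl, ← Finset.card_powersetCard]
  refine Finset.card_bij (fun Q _ => Q.1) ?_ ?_ ?_
  · intro Q hQ
    simp only [Finset.mem_filter, Finset.mem_univ, true_and] at hQ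
    rw [Finset.mem_powersetCard]
    exact ⟨Finset.subset_compl_iff_disjoint_left.2 hQ, Q.2⟩
  · intro Q _ R _ h
    exact Subtype.ext h
  · intro Q hQ
    rw [Finset.mem_powersetCard] at hQ
    exact ⟨⟨Q, hQ.2⟩, by simpa using Finset.subset_compl_iff_disjoint_left.1 hQ.1, rfl⟩

theorem choose_pred_eq {D q : ℕ} (hD : 1 ≤ D) (hq : q ≤ D) :
    ((D - 1).choose q : ℝ) = D.choose q * (1 - (q : ℝ) / D) := by
  obtain ⟨m, rfl⟩ := Nat.exists_eq_add_of_le' hD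
  have h := Nat.choose_mul_succ_eq m q
  have h' : (m.choose q : ℝ) * ((m + 1 : ℕ) : ℝ) = (m + 1).choose q * (((m + 1 : ℕ) : ℝ) - q) := by
    rw [← Nat.cast_sub hq]; exact_mod_cast h
  have : ((m + 1 : ℕ) : ℝ) ≠ 0 := by positivity
  rw [Nat.add_sub_cancel]
  field_simp
  linarith

/-- Under sampling without repetition, missing one point and missing another are negatively
correlated. -/
theorem choose_pred_pred_le {D q : ℕ} (hD : 1 ≤ D) (hq : q ≤ D) :
    ((D - 2).choose q : ℝ) ≤ D.choose q * (1 - (q : ℝ) / D) ^ 2 := by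
  have hD' : (0 : ℝ) < D := by exact_mod_cast hD
  have hqD : (q : ℝ) ≤ D := by exact_mod_cast hq
  have hw : 0 ≤ 1 - (q : ℝ) / D := by
    rw [sub_nonneg, div_le_one hD']; exact hqD
  rcases Nat.lt_or_ge (D - 2) q with h | h
  · rw [Nat.choose_eq_zero_of_lt h]
    simp only [Nat.cast_zero]
    positivity
  -- Truncated subtraction makes `D = 1` a separate case.
  rcases Nat.lt_or_ge D 2 with h2 | h2
  · have : D = 1 := by omega
    subst this
    have : q = 0 := by omega
    subst this
    simp
  have e : D - 2 = D - 1 - 1 := by omega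
  rw [e, choose_pred_eq (by omega) (by omega), choose_pred_eq hD hq, pow_two, mul_assoc]
  have hc : ((D - 1 : ℕ) : ℝ) = D - 1 := by rw [Nat.cast_sub hD]; simp
  have hD1 : (0 : ℝ) < D - 1 := by
    have : (2 : ℝ) ≤ D := by exact_mod_cast h2
    linarith
  have : (q : ℝ) / D ≤ q / ((D - 1 : ℕ) : ℝ) := by
    rw [hc]
    exact div_le_div_of_nonneg_left (by positivity) hD1 (by linarith)
  gcongr

/-- Each factor `(s - j) / (n - j)` of the quotient is at most `s / n`. -/
theorem choose_le_pow_mul_choose {s n : ℕ} (k : ℕ) (hs : s ≤ n) (hn : 0 < n) :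
    (s.choose k : ℝ) ≤ ((s : ℝ) / n) ^ k * n.choose k := by
  induction k with
  | zero => simp
  | succ k ih =>
    have h1 : (s.choose (k + 1) : ℝ) * (k + 1) = s.choose k * ((s - k : ℕ) : ℝ) := by
      exact_mod_cast Nat.choose_succ_right_eq s k
    have h2 : (n.choose (k + 1) : ℝ) * (k + 1) = n.choose k * ((n - k : ℕ) : ℝ) := by
      exact_mod_cast Nat.choose_succ_right_eq n k
    have hn' : (0 : ℝ) < n := by exact_mod_cast hn
    have h3 : ((s - k : ℕ) : ℝ) ≤ (s : ℝ) / n * ((n - k : ℕ) : ℝ) := by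
      rcases Nat.lt_or_ge s k with h | h
      · rw [Nat.sub_eq_zero_of_le h.le]
        simp only [Nat.cast_zero]
        positivity
      · rw [Nat.cast_sub h, Nat.cast_sub (h.trans hs), div_mul_eq_mul_div, le_div_iff₀ hn']
        have : (s : ℝ) ≤ n := by exact_mod_cast hs
        nlinarith [(Nat.cast_nonneg k : (0 : ℝ) ≤ k)]
    have hk : (0 : ℝ) < k + 1 := by positivity
    refine le_of_mul_le_mul_right ?_ hk
    rw [h1, mul_assoc, h2, pow_succ]
    calc (s.choose k : ℝ) * ((s - k : ℕ) : ℝ)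
        ≤ (((s : ℝ) / n) ^ k * n.choose k) * ((s : ℝ) / n * ((n - k : ℕ) : ℝ)) := by
          gcongr
      _ = _ := by ring

/-! ### Overlap of two assignments. -/

/-- The set of variables on which two assignments agree. -/
def agree {n d : ℕ} (σ τ : Fin n → Fin d) : Finset (Fin n) :=
  Finset.univ.filter (fun i => σ i = τ i)

/-- For fixed `σ` the sum over `τ` is a product over variables: one value agrees and contributes
`y`, the other `d - 1` contribute 1. -/
theorem sum_pow_card_agree {n d : ℕ} (y : ℝ) :
    ∑ σ : Fin n → Fin d, ∑ τ : Fin n → Fin d, y ^ (agree σ τ).card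
      = (d : ℝ) ^ n * ((d : ℝ) - 1 + y) ^ n := by
  have h : ∀ σ : Fin n → Fin d, ∑ τ : Fin n → Fin d, y ^ (agree σ τ).card
      = ((d : ℝ) - 1 + y) ^ n := by
    intro σ
    have h1 : ∀ τ : Fin n → Fin d,
        y ^ (agree σ τ).card = ∏ i, (if σ i = τ i then y else 1) := by
      intro τ
      rw [agree, ← Finset.prod_const, Finset.prod_filter]
    simp_rw [h1]
    rw [← Fintype.prod_sum (fun i b => if σ i = b then y else (1 : ℝ))]
    have h2 : ∀ i, ∑ b : Fin d, (if σ i = b then y else (1 : ℝ)) = (d : ℝ) - 1 + y := by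
      intro i
      have : ∀ b : Fin d, (if σ i = b then y else (1 : ℝ)) = 1 + (if σ i = b then y - 1 else 0) := by
        intro b; split_ifs <;> ring
      simp_rw [this]
      rw [Finset.sum_add_distrib, Finset.sum_ite_eq]
      simp
      ring
    simp [h2]
  simp [h]

/-! ### Constraints satisfied by two assignments. -/

open Classical in
/-- The number of constraints satisfied by both `σ` and `τ`. -/
noncomputable def jointCount {n d : ℕ} (k q : ℕ) (σ τ : Fin n → Fin d) : ℕ :=
  (Finset.univ.filter (fun C : Constraint n k d q => C.SatisfiedBy σ ∧ C.SatisfiedBy τ)).card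

-- The forbidden set must miss both tuples; the pair, as a `Finset`, collapses to one element when
-- they coincide.
open Classical in
theorem jointCount_eq_sum {n d : ℕ} (k q : ℕ) (σ τ : Fin n → Fin d) :
    jointCount k q σ τ = ∑ S : {S : Finset (Fin n) // S.card = k},
      (d ^ k - ({fun j => σ (S.1.orderEmbOfFin S.2 j), fun j => τ (S.1.orderEmbOfFin S.2 j)} :
        Finset (Fin k → Fin d)).card).choose q := by
  rw [jointCount, Finset.card_filter, Fintype.sum_prod_type]
  refine Finset.sum_congr rfl fun S _ => ?_
  have := card_filter_disjoint q ({fun j => σ (S.1.orderEmbOfFin S.2 j),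
    fun j => τ (S.1.orderEmbOfFin S.2 j)} : Finset (Fin k → Fin d))
  rw [Fintype.card_fun, Fintype.card_fin, Fintype.card_fin] at this
  rw [← this, Finset.card_filter]
  refine Finset.sum_congr rfl fun Q _ => ?_
  congr 1
  simp only [Constraint.SatisfiedBy, Finset.disjoint_insert_left, Finset.disjoint_singleton_left]
  rfl

theorem card_scopes (n k : ℕ) :
    Fintype.card {S : Finset (Fin n) // S.card = k} = n.choose k := by
  simp

theorem card_constraint (n k d q : ℕ) :
    Fintype.card (Constraint n k d q) = n.choose k * (d ^ k).choose q := by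
  simp [Constraint]

theorem jointCount_self {n d k q : ℕ} (hd : 1 ≤ d) (hq : q ≤ d ^ k) (σ : Fin n → Fin d) :
    (jointCount k q σ σ : ℝ)
      = Fintype.card (Constraint n k d q) * (1 - (q : ℝ) / (d : ℝ) ^ k) := by
  have := choose_pred_eq (Nat.one_le_pow _ _ hd) hq
  rw [jointCount_eq_sum, card_constraint]
  simp
  rw [this]
  push_cast
  ring

open Classical in
theorem jointCount_le {n d k q : ℕ} (hn : 0 < n) (hd : 1 ≤ d) (hq : q ≤ d ^ k) {c : ℝ} (hc : 0 ≤ c)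
    (hw : 1 ≤ (1 - (q : ℝ) / (d : ℝ) ^ k) * (1 + c)) (σ τ : Fin n → Fin d) :
    (jointCount k q σ τ : ℝ) ≤ Fintype.card (Constraint n k d q) *
      ((1 - (q : ℝ) / (d : ℝ) ^ k) ^ 2 * (1 + c * (((agree σ τ).card : ℝ) / n) ^ k)) := by
  set w : ℝ := 1 - (q : ℝ) / (d : ℝ) ^ k with hwdef
  have h1 := choose_pred_eq (Nat.one_le_pow k _ hd) hq
  have h2 := choose_pred_pred_le (Nat.one_le_pow k _ hd) hq
  push_cast at h1 h2
  rw [← hwdef] at h1 h2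
  have hw0 : 0 < w := by
    by_contra h
    push Not at h
    nlinarith
  -- If the tuples coincide the compatible fraction is `w ≤ w² (1 + c)`, otherwise at most `w²`; the
  -- excess `c` is charged only to scopes inside the agreement set.
  have key : ∀ S : {S : Finset (Fin n) // S.card = k},
      (((d ^ k - ({fun j => σ (S.1.orderEmbOfFin S.2 j),
        fun j => τ (S.1.orderEmbOfFin S.2 j)} : Finset (Fin k → Fin d)).card).choose q : ℕ) : ℝ)
      ≤ (d ^ k).choose q * w ^ 2 + (d ^ k).choose q * w ^ 2 * c *
        (if S.1 ⊆ agree σ τ then 1 else 0) := by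
    intro S
    by_cases h : (fun j => σ (S.1.orderEmbOfFin S.2 j)) = fun j => τ (S.1.orderEmbOfFin S.2 j)
    · have hS : S.1 ⊆ agree σ τ := by
        intro i hi
        have : i ∈ Set.range (S.1.orderEmbOfFin S.2) := by
          rw [Finset.range_orderEmbOfFin]; exact hi
        obtain ⟨j, rfl⟩ := this
        simp only [agree, Finset.mem_filter, Finset.mem_univ, true_and]
        exact congrFun h j
      rw [h]
      simp only [Finset.pair_eq_singleton, Finset.card_singleton, if_pos hS]
      rw [h1]
      have : (0 : ℝ) ≤ (d ^ k).choose q * w := by positivity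
      nlinarith
    · rw [Finset.card_pair h]
      refine h2.trans ?_
      have : (0 : ℝ) ≤ (d ^ k).choose q * w ^ 2 * c * (if S.1 ⊆ agree σ τ then 1 else 0) := by
        split_ifs <;> positivity
      linarith
  have hcount : ∑ S : {S : Finset (Fin n) // S.card = k},
      (if S.1 ⊆ agree σ τ then (1 : ℝ) else 0) = ((agree σ τ).card.choose k : ℝ) := by
    rw [← Finset.card_powersetCard, Finset.sum_boole]
    congr 1
    refine Finset.card_bij (fun S _ => S.1) ?_ ?_ ?_
    · intro S hS
      simp only [Finset.mem_filter, Finset.mem_univ, true_and] at hS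
      exact Finset.mem_powersetCard.2 ⟨hS, S.2⟩
    · intro S _ T _ h
      exact Subtype.ext h
    · intro S hS
      rw [Finset.mem_powersetCard] at hS
      exact ⟨⟨S, hS.2⟩, by simpa using hS.1, rfl⟩
  have hs : (agree σ τ).card ≤ n := by
    simpa using Finset.card_le_univ (agree σ τ)
  have hch := choose_le_pow_mul_choose k hs hn
  rw [jointCount_eq_sum, card_constraint]
  push_cast
  refine (Finset.sum_le_sum fun S _ => key S).trans ?_
  rw [Finset.sum_add_distrib, Finset.sum_const, Finset.card_univ, card_scopes, nsmul_eq_mul,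
    ← Finset.mul_sum, hcount]
  calc _ ≤ (n.choose k : ℝ) * ((d ^ k).choose q * w ^ 2) + (d ^ k).choose q * w ^ 2 * c *
        ((((agree σ τ).card : ℝ) / n) ^ k * n.choose k) := by gcongr
    _ = _ := by ring

/-! ### First and second moments of the number of solutions. -/

open Classical in
/-- The number of solutions of an instance. -/
noncomputable def numSol {n k d t q : ℕ} (I : Instance n k d t q) : ℕ :=
  (Finset.univ.filter (fun σ : Fin n → Fin d => ∀ i, (I i).SatisfiedBy σ)).card

theorem numSol_pos_iff {n k d t q : ℕ} (I : Instance n k d t q) :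
    0 < numSol I ↔ I.Satisfiable := by
  classical
  simp [numSol, Finset.card_pos, Finset.Nonempty, Instance.Satisfiable]

open Classical in
theorem card_filter_forall {n k d t q : ℕ} (P : Constraint n k d q → Prop) :
    (Finset.univ.filter (fun I : Instance n k d t q => ∀ i, P (I i))).card
      = (Finset.univ.filter P).card ^ t := by
  have : (Finset.univ.filter (fun I : Instance n k d t q => ∀ i, P (I i)))
      = Fintype.piFinset (fun _ : Fin t => Finset.univ.filter P) := by
    ext I; simp [Fintype.mem_piFinset]
  rw [this, Fintype.card_piFinset]
  simp

theorem sum_numSol_sq {n k d t q : ℕ} :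
    ∑ I : Instance n k d t q, (numSol I : ℝ) ^ 2
      = ∑ σ : Fin n → Fin d, ∑ τ : Fin n → Fin d, (jointCount k q σ τ : ℝ) ^ t := by
  classical
  have h : ∀ I : Instance n k d t q, (numSol I : ℝ) ^ 2
      = ∑ σ : Fin n → Fin d, ∑ τ : Fin n → Fin d,
        if (∀ i, (I i).SatisfiedBy σ ∧ (I i).SatisfiedBy τ) then (1 : ℝ) else 0 := by
    intro I
    rw [numSol, pow_two, Finset.card_filter]
    push_cast
    rw [Finset.sum_mul_sum]
    refine Finset.sum_congr rfl fun σ _ => Finset.sum_congr rfl fun τ _ => ?_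
    by_cases h1 : ∀ i, (I i).SatisfiedBy σ <;> by_cases h2 : ∀ i, (I i).SatisfiedBy τ <;>
      simp [h1, h2, forall_and]
  simp_rw [h]
  rw [Finset.sum_comm]
  refine Finset.sum_congr rfl fun σ _ => ?_
  rw [Finset.sum_comm]
  refine Finset.sum_congr rfl fun τ _ => ?_
  have e := card_filter_forall (t := t)
    (fun C : Constraint n k d q => C.SatisfiedBy σ ∧ C.SatisfiedBy τ)
  rw [Finset.sum_boole, jointCount, ← Nat.cast_pow]
  refine congrArg Nat.cast ?_
  convert e

theorem sum_numSol {n k d t q : ℕ} :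
    ∑ I : Instance n k d t q, (numSol I : ℝ)
      = ∑ σ : Fin n → Fin d, (jointCount k q σ σ : ℝ) ^ t := by
  classical
  simp_rw [numSol, Finset.card_filter]
  push_cast
  rw [Finset.sum_comm]
  refine Finset.sum_congr rfl fun σ _ => ?_
  rw [Finset.sum_boole, card_filter_forall (fun C => C.SatisfiedBy σ), jointCount]
  simp

open Classical in
theorem prSat_eq (n k d t q : ℕ) :
    prSat n k d t q = ((Finset.univ.filter
      (fun I : Instance n k d t q => I.Satisfiable)).card : ℝ)
        / (Fintype.card (Constraint n k d q) : ℝ) ^ t := by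
  rw [prSat, Nat.card_eq_fintype_card, Nat.card_eq_fintype_card, Fintype.card_subtype,
    Fintype.card_fun, Fintype.card_fin]
  push_cast
  rfl

theorem prSat_nonneg (n k d t q : ℕ) : 0 ≤ prSat n k d t q := by
  rw [prSat]; positivity

theorem prSat_le_one (n k d t q : ℕ) : prSat n k d t q ≤ 1 := by
  rw [prSat]
  refine div_le_one_of_le₀ ?_ (by positivity)
  exact_mod_cast Finite.card_subtype_le _

theorem card_constraint_pos {n k d q : ℕ} (hk : k ≤ n) (hq : q ≤ d ^ k) :
    0 < (Fintype.card (Constraint n k d q) : ℝ) := by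
  rw [card_constraint]
  exact_mod_cast Nat.mul_pos (Nat.choose_pos hk) (Nat.choose_pos hq)

/-- First moment bound. -/
theorem prSat_le {n k d t q : ℕ} (hk : k ≤ n) (hd : 1 ≤ d) (hq : q ≤ d ^ k) :
    prSat n k d t q ≤ (d : ℝ) ^ n * (1 - (q : ℝ) / (d : ℝ) ^ k) ^ t := by
  classical
  have hM := card_constraint_pos hk hq
  rw [prSat_eq, div_le_iff₀ (pow_pos hM t), mul_assoc, ← mul_pow, mul_comm (1 - _)]
  have h := sum_numSol (n := n) (k := k) (d := d) (t := t) (q := q)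
  simp_rw [jointCount_self hd hq] at h
  rw [Finset.sum_const, Finset.card_univ, Fintype.card_fun, Fintype.card_fin, Fintype.card_fin,
    nsmul_eq_mul] at h
  push_cast at h
  rw [← h, ← Finset.sum_boole]
  refine Finset.sum_le_sum fun I _ => ?_
  split_ifs with hI
  · exact_mod_cast (numSol_pos_iff I).2 hI
  · positivity

/-- Second moment bound. -/
theorem le_prSat_mul_sum {n k d t q : ℕ} (hn : 0 < n) (hk : k ≤ n) (hd : 1 ≤ d) (hq : q ≤ d ^ k)
    {c : ℝ} (hc : 0 ≤ c) (hw : 1 ≤ (1 - (q : ℝ) / (d : ℝ) ^ k) * (1 + c)) :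
    ((d : ℝ) ^ n) ^ 2 ≤ prSat n k d t q * ∑ σ : Fin n → Fin d, ∑ τ : Fin n → Fin d,
      (1 + c * (((agree σ τ).card : ℝ) / n) ^ k) ^ t := by
  classical
  have hM := card_constraint_pos hk hq
  set M : ℝ := (Fintype.card (Constraint n k d q) : ℝ) with hMdef
  set w : ℝ := 1 - (q : ℝ) / (d : ℝ) ^ k with hwdef
  have hw0 : 0 < w := by
    by_contra h
    push Not at h
    nlinarith
  have h1 : ∑ I : Instance n k d t q, (numSol I : ℝ) = (d : ℝ) ^ n * (M * w) ^ t := by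
    rw [sum_numSol]
    simp_rw [jointCount_self hd hq]
    simp [hMdef, hwdef]
  have h2 : ∑ I : Instance n k d t q, (numSol I : ℝ) ^ 2 ≤ (M * w ^ 2) ^ t *
      ∑ σ : Fin n → Fin d, ∑ τ : Fin n → Fin d,
        (1 + c * (((agree σ τ).card : ℝ) / n) ^ k) ^ t := by
    rw [sum_numSol_sq]
    simp_rw [Finset.mul_sum, ← mul_pow]
    refine Finset.sum_le_sum fun σ _ => Finset.sum_le_sum fun τ _ => ?_
    have := jointCount_le hn hd hq hc hw σ τ
    rw [← mul_assoc] at this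
    exact pow_le_pow_left₀ (by positivity) this t
  have h3 : (∑ I : Instance n k d t q, (numSol I : ℝ)) ^ 2 ≤
      ((Finset.univ.filter (fun I : Instance n k d t q => I.Satisfiable)).card : ℝ) *
        ∑ I : Instance n k d t q, (numSol I : ℝ) ^ 2 := by
    -- Cauchy-Schwarz for `numSol` against the indicator of satisfiability.
    have := Finset.sum_mul_sq_le_sq_mul_sq Finset.univ
      (fun I : Instance n k d t q => if I.Satisfiable then (1 : ℝ) else 0)
      (fun I => (numSol I : ℝ))
    have e1 : ∀ I : Instance n k d t q,
        (if I.Satisfiable then (1 : ℝ) else 0) * (numSol I : ℝ) = numSol I := by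
      intro I
      split_ifs with hI
      · simp
      · have : numSol I = 0 := by
          by_contra h
          exact hI ((numSol_pos_iff I).1 (Nat.pos_of_ne_zero h))
        simp [this]
    simp_rw [e1] at this
    simpa [Finset.sum_boole] using this
  rw [prSat_eq, ← hMdef]
  set Z : ℝ := ((Finset.univ.filter (fun I : Instance n k d t q => I.Satisfiable)).card : ℝ)
  set R : ℝ := ∑ σ : Fin n → Fin d, ∑ τ : Fin n → Fin d,
        (1 + c * (((agree σ τ).card : ℝ) / n) ^ k) ^ t
  rw [h1] at h3
  have h4 : ((d : ℝ) ^ n * (M * w) ^ t) ^ 2 ≤ Z * ((M * w ^ 2) ^ t * R) :=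
    h3.trans (mul_le_mul_of_nonneg_left h2 (by positivity))
  have hpos : 0 < (M * w ^ 2) ^ t := by positivity
  rw [div_mul_eq_mul_div, le_div_iff₀ (pow_pos hM t)]
  refine le_of_mul_le_mul_right ?_ hpos
  calc ((d : ℝ) ^ n) ^ 2 * M ^ t * (M * w ^ 2) ^ t = ((d : ℝ) ^ n * (M * w) ^ t) ^ 2 := by
        simp only [mul_pow, ← pow_mul]; ring
    _ ≤ _ := h4
    _ = _ := by ring

/-! ### Estimates of the overlap weight. -/

/-- The quotient `log (1 + c y^k) / y` is nondecreasing on `(0, 1]`; compare `y = x` with `y = 1`.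
-/
theorem log_one_add_mul_pow_le {k : ℕ} {c x : ℝ} (hc : 0 ≤ c) (hck : 1 + c ≤ k)
    (hx : 0 ≤ x) (hx1 : x ≤ 1) : Real.log (1 + c * x ^ k) ≤ x * Real.log (1 + c) := by
  have hk : k ≠ 0 := by
    rintro rfl
    simp only [Nat.cast_zero] at hck
    linarith
  rcases hx.eq_or_lt with rfl | hx
  · simp [hk]
  have hpos : ∀ y : ℝ, 0 < y → 0 < 1 + c * y ^ k := fun y hy => by positivity
  have hderiv : ∀ y : ℝ, 0 < y → HasDerivAt (fun y => Real.log (1 + c * y ^ k) / y)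
      (((c * (k * y ^ (k - 1))) / (1 + c * y ^ k) * y - Real.log (1 + c * y ^ k) * 1) / y ^ 2) y := by
    intro y hy
    have h1 : HasDerivAt (fun y : ℝ => 1 + c * y ^ k) (c * (k * y ^ (k - 1))) y :=
      ((hasDerivAt_pow k y).const_mul c).const_add 1
    exact (h1.log (hpos y hy).ne').div (hasDerivAt_id y) hy.ne'
  have hmono : MonotoneOn (fun y => Real.log (1 + c * y ^ k) / y) (Set.Ioc 0 1) := by
    refine monotoneOn_of_deriv_nonneg (convex_Ioc 0 1) ?_ ?_ ?_
    · exact fun y hy => (hderiv y hy.1).continuousAt.continuousWithinAt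
    · rw [interior_Ioc]
      exact fun y hy => (hderiv y hy.1).differentiableAt.differentiableWithinAt
    · rw [interior_Ioc]
      intro y hy
      rw [(hderiv y hy.1).deriv]
      refine div_nonneg ?_ (by positivity)
      have hv := hpos y hy.1
      have hyk : y ^ (k - 1) * y = y ^ k := pow_sub_one_mul hk y
      have e : (c * (k * y ^ (k - 1))) / (1 + c * y ^ k) * y = k * (c * y ^ k) / (1 + c * y ^ k) := by
        rw [← hyk]; ring
      have hlog := Real.log_le_sub_one_of_pos hv
      have hy1 : y ^ k ≤ 1 := pow_le_one₀ hy.1.le hy.2.le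
      -- Here `1 + c ≤ k` enters: `1 + c y^k ≤ 1 + c ≤ k`.
      have hle : c * y ^ k ≤ k * (c * y ^ k) / (1 + c * y ^ k) := by
        rw [le_div_iff₀ hv, mul_comm]
        have : 0 ≤ c * y ^ k := mul_nonneg hc (pow_nonneg hy.1.le k)
        refine mul_le_mul_of_nonneg_right ?_ this
        nlinarith
      rw [e]
      linarith
  have := hmono (Set.mem_Ioc.2 ⟨hx, hx1⟩) (Set.mem_Ioc.2 ⟨one_pos, le_rfl⟩) hx1
  simp only [one_pow, mul_one, div_one] at this
  rw [div_le_iff₀ hx] at this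
  linarith

theorem one_add_mul_pow_pow_le_exp {k t : ℕ} {c x : ℝ} (hc : 0 ≤ c) (hx : 0 ≤ x) :
    (1 + c * x ^ k) ^ t ≤ Real.exp (t * (c * x ^ k)) := by
  rw [Real.exp_nat_mul]
  refine pow_le_pow_left₀ (by positivity) ?_ t
  linarith [Real.add_one_le_exp (c * x ^ k)]

/-- A bound of the overlap weight by exponentials that are linear in the overlap `s`. -/
theorem overlap_weight_le {k n t s : ℕ} {α β η δ ε r c : ℝ} (hk : 2 ≤ k) (hn : 1 ≤ n) (hs : s ≤ n)
    (hc : 0 ≤ c) (hck : 1 + c ≤ k) (hη : 0 ≤ η) (hδ : 0 ≤ δ)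
    (ht : (t : ℝ) ≤ r * n * Real.log n) (hcε : c * ε * r ≤ η) (hrc : r * Real.log (1 + c) ≤ α - δ) :
    (1 + c * ((s : ℝ) / n) ^ k) ^ t ≤
      Real.exp (c * r * ((n : ℝ) ^ (1 - k * β) * Real.log n))
      + Real.exp (-(η * (n : ℝ) ^ (1 - β) * Real.log n)) * ((n : ℝ) ^ (2 * η)) ^ s
      + Real.exp (-(δ * ε * n * Real.log n)) * ((n : ℝ) ^ α) ^ s := by
  have hn0 : (0 : ℝ) < n := by exact_mod_cast hn
  have hL : 0 ≤ Real.log n := Real.log_natCast_nonneg n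
  set ℓ := Real.log n with hℓ
  have hT : 0 ≤ r * n * ℓ := (Nat.cast_nonneg t).trans ht
  have hsn : (s : ℝ) ≤ n := by exact_mod_cast hs
  set x : ℝ := (s : ℝ) / n with hx
  have hx0 : 0 ≤ x := by positivity
  have hx1 : x ≤ 1 := div_le_one_of_le₀ hsn hn0.le
  have hxn : (s : ℝ) = x * n := by rw [hx]; field_simp
  have hpow : ∀ a : ℝ, ((n : ℝ) ^ a) ^ s = Real.exp (a * s * ℓ) := by
    intro a
    rw [Real.rpow_def_of_pos hn0, ← Real.exp_nat_mul]
    congr 1; ring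
  rw [hpow, hpow, ← Real.exp_add, ← Real.exp_add]
  have p1 := Real.exp_pos (c * r * ((n : ℝ) ^ (1 - k * β) * ℓ))
  have p2 := Real.exp_pos (-(η * (n : ℝ) ^ (1 - β) * ℓ) + 2 * η * s * ℓ)
  have p3 := Real.exp_pos (-(δ * ε * n * ℓ) + α * s * ℓ)
  -- In each of the three ranges of `x` one summand dominates and the other two are positive.
  by_cases h1 : x ≤ (n : ℝ) ^ (-β)
  · have h2 : x ^ k ≤ (n : ℝ) ^ (-(k * β)) := by
      calc x ^ k ≤ ((n : ℝ) ^ (-β)) ^ k := pow_le_pow_left₀ hx0 h1 k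
        _ = _ := by rw [← Real.rpow_mul_natCast hn0.le]; congr 1; ring
    have h3 : (t : ℝ) * (c * x ^ k) ≤ c * r * ((n : ℝ) ^ (1 - k * β) * ℓ) := by
      calc (t : ℝ) * (c * x ^ k) ≤ (r * n * ℓ) * (c * (n : ℝ) ^ (-(k * β))) := by gcongr
        _ = c * r * ((n : ℝ) ^ (1 - k * β) * ℓ) := by
          rw [sub_eq_add_neg, Real.rpow_add hn0, Real.rpow_one]; ring
    have := (one_add_mul_pow_pow_le_exp (k := k) (t := t) hc hx0).trans (Real.exp_le_exp.2 h3)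
    linarith
  by_cases h2 : x ≤ ε
  · push Not at h1
    have h3 : x ^ k ≤ ε * x := by
      calc x ^ k ≤ x ^ 2 := pow_le_pow_of_le_one hx0 hx1 hk
        _ = x * x := pow_two x
        _ ≤ ε * x := by gcongr
    have h4 : (n : ℝ) ^ (1 - β) ≤ s := by
      rw [sub_eq_add_neg, Real.rpow_add hn0, Real.rpow_one, hxn, mul_comm]
      gcongr
    -- Doubling the rate `η` buys the decaying prefactor, because `s ≥ n^(1 - β)`.
    have h5 : (t : ℝ) * (c * x ^ k) ≤ -(η * (n : ℝ) ^ (1 - β) * ℓ) + 2 * η * s * ℓ := by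
      have hε0 : 0 ≤ ε := hx0.trans h2
      calc (t : ℝ) * (c * x ^ k) ≤ (r * n * ℓ) * (c * (ε * x)) := by gcongr
        _ = (c * ε * r) * (s * ℓ) := by rw [hxn]; ring
        _ ≤ η * (s * ℓ) := by gcongr
        _ ≤ _ := by nlinarith [mul_le_mul_of_nonneg_left h4 (mul_nonneg hη hL)]
    have := (one_add_mul_pow_pow_le_exp (k := k) (t := t) hc hx0).trans (Real.exp_le_exp.2 h5)
    linarith
  · push Not at h2
    -- The slack `δ` in the rate, with `s ≥ ε n`, yields the prefactor.
    have h3 : (1 + c * x ^ k) ^ t ≤ Real.exp (-(δ * ε * n * ℓ) + α * s * ℓ) := by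
      rw [← Real.log_le_iff_le_exp (by positivity), Real.log_pow]
      have h6 : 0 ≤ Real.log (1 + c) := Real.log_nonneg (by linarith)
      calc (t : ℝ) * Real.log (1 + c * x ^ k) ≤ (r * n * ℓ) * (x * Real.log (1 + c)) := by
            gcongr
            · exact Real.log_nonneg (by have : 0 ≤ c * x ^ k := by positivity
                                        linarith)
            · exact log_one_add_mul_pow_le hc hck hx0 hx1
        _ = (r * Real.log (1 + c)) * (s * ℓ) := by rw [hxn]; ring
        _ ≤ (α - δ) * (s * ℓ) := by gcongr
        _ ≤ _ := by
          have : ε * n ≤ s := by rw [hxn]; gcongr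
          nlinarith [mul_le_mul_of_nonneg_left this (mul_nonneg hδ hL)]
    linarith

/-! ### Averaging the weight over all pairs. -/

theorem sum_pow_card_agree_le {n d : ℕ} (hd : 1 ≤ d) {y : ℝ} (hy : 0 ≤ y) :
    ∑ σ : Fin n → Fin d, ∑ τ : Fin n → Fin d, y ^ (agree σ τ).card
      ≤ ((d : ℝ) ^ n) ^ 2 * Real.exp (n * (y / d)) := by
  have hd0 : (0 : ℝ) < d := by exact_mod_cast hd
  have hd1 : (1 : ℝ) ≤ d := by exact_mod_cast hd
  rw [sum_pow_card_agree, Real.exp_nat_mul, pow_two, mul_assoc, ← mul_pow (d : ℝ) (Real.exp _)]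
  gcongr
  calc (d : ℝ) - 1 + y ≤ d * (y / d + 1) := by
        rw [mul_add, mul_div_cancel₀ _ hd0.ne']; linarith
    _ ≤ _ := by gcongr; exact Real.add_one_le_exp _

theorem sum_overlap_weight_le {k n t d : ℕ} {α β δ ε r c : ℝ} (hk : 2 ≤ k) (hn : 1 ≤ n)
    (hd : (n : ℝ) ^ α / 2 ≤ d) (hβ : β ≤ α)
    (hc : 0 ≤ c) (hck : 1 + c ≤ k) (hδ : 0 ≤ δ)
    (ht : (t : ℝ) ≤ r * n * Real.log n) (hcε : c * ε * r ≤ (α - β) / 2)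
    (hrc : r * Real.log (1 + c) ≤ α - δ) :
    ∑ σ : Fin n → Fin d, ∑ τ : Fin n → Fin d, (1 + c * (((agree σ τ).card : ℝ) / n) ^ k) ^ t ≤
      ((d : ℝ) ^ n) ^ 2 * (Real.exp (c * r * ((n : ℝ) ^ (1 - k * β) * Real.log n))
      + Real.exp ((n : ℝ) ^ (1 - β) * (2 - (α - β) / 2 * Real.log n))
      + Real.exp (n * (2 - δ * ε * Real.log n))) := by
  have hn0 : (0 : ℝ) < n := by exact_mod_cast hn
  have hnα : 0 < (n : ℝ) ^ α := Real.rpow_pos_of_pos hn0 α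
  have hd0 : (0 : ℝ) < d := by linarith
  have hd1 : 1 ≤ d := by exact_mod_cast hd0
  -- This `η` makes `1 + 2η - α = 1 - β`, so summation costs `2 n^(1 - β)`, which the prefactor
  -- beats by a factor of order `log n`.
  set η := (α - β) / 2 with hη
  have hcard : ∀ σ τ : Fin n → Fin d, (agree σ τ).card ≤ n := fun σ τ => by
    simpa using Finset.card_le_univ (agree σ τ)
  have hη0 : 0 ≤ η := by rw [hη]; linarith
  have hdiv : ∀ a : ℝ, (n : ℝ) * ((n : ℝ) ^ a / d) ≤ 2 * (n : ℝ) ^ (1 + a - α) := by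
    intro a
    rw [Real.rpow_sub hn0, Real.rpow_add hn0, Real.rpow_one, ← mul_div_assoc, ← mul_div_assoc,
      div_le_div_iff₀ hd0 hnα]
    have : 0 < (n : ℝ) * (n : ℝ) ^ a := mul_pos hn0 (Real.rpow_pos_of_pos hn0 a)
    nlinarith
  refine (Finset.sum_le_sum fun σ _ => Finset.sum_le_sum fun τ _ =>
    overlap_weight_le (β := β) hk hn (hcard σ τ) hc hck hη0 hδ ht hcε hrc).trans ?_
  simp only [Finset.sum_add_distrib, ← Finset.mul_sum]
  rw [mul_add, mul_add]
  refine add_le_add (add_le_add ?_ ?_) ?_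
  · simp
    apply le_of_eq
    ring
  · refine (mul_le_mul_of_nonneg_left (sum_pow_card_agree_le hd1 (by positivity))
      (Real.exp_pos _).le).trans ?_
    rw [mul_left_comm, ← Real.exp_add]
    gcongr
    have := hdiv (2 * η)
    rw [show 1 + 2 * η - α = 1 - β by rw [hη]; ring] at this
    linarith
  · refine (mul_le_mul_of_nonneg_left (sum_pow_card_agree_le hd1 (by positivity))
      (Real.exp_pos _).le).trans ?_
    rw [mul_left_comm, ← Real.exp_add]
    gcongr
    have := hdiv α
    rw [show 1 + α - α = 1 by ring, Real.rpow_one] at this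
    linarith

/-! ### Limits of the bounds. -/

theorem tendsto_log_natCast : Tendsto (fun n : ℕ => Real.log (n : ℝ)) atTop atTop :=
  Real.tendsto_log_atTop.comp tendsto_natCast_atTop_atTop

theorem tendsto_rpow_neg_mul_log {a : ℝ} (ha : a < 0) :
    Tendsto (fun n : ℕ => (n : ℝ) ^ a * Real.log n) atTop (𝓝 0) := by
  have h := (isLittleO_log_rpow_atTop (neg_pos.2 ha)).tendsto_div_nhds_zero
  refine (h.comp tendsto_natCast_atTop_atTop).congr' ?_
  filter_upwards [eventually_ge_atTop 1] with n hn
  have hn0 : (0 : ℝ) ≤ n := by positivity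
  simp only [Function.comp_apply]
  rw [Real.rpow_neg hn0, div_inv_eq_mul, mul_comm]

theorem tendsto_const_sub_mul_log {a b : ℝ} (hb : 0 < b) :
    Tendsto (fun n : ℕ => a - b * Real.log n) atTop atBot := by
  have := (tendsto_log_natCast.const_mul_atTop hb)
  simpa [sub_eq_add_neg] using
    tendsto_atBot_add_const_left atTop a (tendsto_neg_atTop_atBot.comp this)

theorem tendsto_exp_rpow_mul_sub_log {s a b : ℝ} (hs : 0 < s) (hb : 0 < b) :
    Tendsto (fun n : ℕ => Real.exp ((n : ℝ) ^ s * (a - b * Real.log n))) atTop (𝓝 0) :=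
  Real.tendsto_exp_atBot.comp
    (((tendsto_rpow_atTop hs).comp tendsto_natCast_atTop_atTop).atTop_mul_atBot₀
      (tendsto_const_sub_mul_log hb))

theorem tendsto_overlap_bound {k : ℕ} {α β δ ε r c : ℝ} (hβ : β < α) (hβ1 : β < 1)
    (hkβ : 1 < k * β) (hδε : 0 < δ * ε) :
    Tendsto (fun n : ℕ => Real.exp (c * r * ((n : ℝ) ^ (1 - k * β) * Real.log n))
      + Real.exp ((n : ℝ) ^ (1 - β) * (2 - (α - β) / 2 * Real.log n))
      + Real.exp (n * (2 - δ * ε * Real.log n))) atTop (𝓝 1) := by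
  have h1 : Tendsto (fun n : ℕ => Real.exp (c * r * ((n : ℝ) ^ (1 - k * β) * Real.log n)))
      atTop (𝓝 1) := by
    have := (tendsto_rpow_neg_mul_log (show 1 - k * β < 0 by linarith)).const_mul (c * r)
    rw [mul_zero] at this
    simpa [Function.comp_def] using (Real.continuous_exp.tendsto 0).comp this
  have h2 := tendsto_exp_rpow_mul_sub_log (s := 1 - β) (a := 2) (b := (α - β) / 2)
    (by linarith) (by linarith)
  have h3 := tendsto_exp_rpow_mul_sub_log (s := 1) (a := 2) one_pos hδε
  simp only [Real.rpow_one] at h3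
  simpa using (h1.add h2).add h3

/-! ### Effect of rounding, and the two limits. -/

section Rounding

variable {k : ℕ} {α r p : ℝ} {d t q : ℕ → ℕ}

theorem tendsto_rpow_natCast (hα : 0 < α) : Tendsto (fun n : ℕ => (n : ℝ) ^ α) atTop atTop :=
  (tendsto_rpow_atTop hα).comp tendsto_natCast_atTop_atTop

theorem eventually_rpow_div_two_le (hα : 0 < α) (hd : ∀ n : ℕ, IsRounding (d n) ((n : ℝ) ^ α)) :
    ∀ᶠ n : ℕ in atTop, (n : ℝ) ^ α / 2 ≤ d n := by
  filter_upwards [(tendsto_rpow_natCast hα).eventually_ge_atTop 2] with n hn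
  have := (abs_lt.1 (hd n)).1
  linarith

theorem eventually_le_two_mul_rpow (hα : 0 < α) (hd : ∀ n : ℕ, IsRounding (d n) ((n : ℝ) ^ α)) :
    ∀ᶠ n : ℕ in atTop, (d n : ℝ) ≤ 2 * (n : ℝ) ^ α := by
  filter_upwards [(tendsto_rpow_natCast hα).eventually_ge_atTop 1] with n hn
  have := (abs_lt.1 (hd n)).2
  linarith

theorem eventually_one_le (hα : 0 < α) (hd : ∀ n : ℕ, IsRounding (d n) ((n : ℝ) ^ α)) :
    ∀ᶠ n : ℕ in atTop, 1 ≤ d n := by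
  filter_upwards [eventually_rpow_div_two_le hα hd,
    (tendsto_rpow_natCast hα).eventually_ge_atTop 1] with n hn h1
  have : (0 : ℝ) < d n := by linarith
  exact_mod_cast this

theorem tendsto_density (hk : k ≠ 0) (hα : 0 < α) (hd : ∀ n : ℕ, IsRounding (d n) ((n : ℝ) ^ α))
    (hq : ∀ n : ℕ, IsRounding (q n) (p * (d n : ℝ) ^ k)) :
    Tendsto (fun n => (q n : ℝ) / (d n : ℝ) ^ k) atTop (𝓝 p) := by
  have hdt : Tendsto (fun n => (d n : ℝ)) atTop atTop :=
    tendsto_atTop_mono' _ (eventually_rpow_div_two_le hα hd)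
      ((tendsto_rpow_natCast hα).atTop_div_const two_pos)
  have h0 : Tendsto (fun n => ((d n : ℝ) ^ k)⁻¹) atTop (𝓝 0) :=
    ((tendsto_pow_atTop hk).comp hdt).inv_tendsto_atTop
  rw [tendsto_iff_dist_tendsto_zero]
  refine squeeze_zero' (Eventually.of_forall fun n => dist_nonneg) ?_ h0
  filter_upwards [eventually_one_le hα hd] with n hn
  have hpos : 0 < (d n : ℝ) ^ k := pow_pos (by exact_mod_cast hn) k
  have e : (q n : ℝ) / (d n : ℝ) ^ k - p = (q n - p * (d n : ℝ) ^ k) / (d n : ℝ) ^ k := by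
    field_simp
  rw [Real.dist_eq, e, abs_div, abs_of_pos hpos, div_le_iff₀ hpos, inv_mul_cancel₀ hpos.ne']
  exact (hq n).le

theorem le_pow_of_isRounding (hp1 : p ≤ 1) {m D : ℕ} (h : IsRounding m (p * (D : ℝ) ^ k)) :
    m ≤ D ^ k := by
  have h1 := (abs_lt.1 h).2
  have h2 : (m : ℝ) < ((D ^ k + 1 : ℕ) : ℝ) := by
    have : p * (D : ℝ) ^ k ≤ 1 * (D : ℝ) ^ k := by gcongr
    push_cast
    linarith
  exact Nat.lt_succ_iff.1 (by exact_mod_cast h2)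

/-- The rounding error is absorbed by a slightly larger `r'`. -/
theorem eventually_le_mul_log {r' : ℝ} (hr' : r < r')
    (ht : ∀ n : ℕ, IsRounding (t n) (r * (n : ℝ) * Real.log (n : ℝ))) :
    ∀ᶠ n : ℕ in atTop, (t n : ℝ) ≤ r' * n * Real.log n := by
  have h : Tendsto (fun n : ℕ => (r' - r) * ((n : ℝ) * Real.log n)) atTop atTop :=
    (tendsto_natCast_atTop_atTop.atTop_mul_atTop₀ tendsto_log_natCast).const_mul_atTop
      (sub_pos.2 hr')
  filter_upwards [h.eventually_ge_atTop 1] with n hn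
  have := (abs_lt.1 (ht n)).2
  nlinarith

theorem tendsto_prSat_one (hk : 2 ≤ k) (hα : 1 / (k : ℝ) < α) (hr : 0 < r)
    (hkr : 1 ≤ (k : ℝ) * Real.exp (-(α / r))) (hp0 : 0 ≤ p)
    (hd : ∀ n : ℕ, IsRounding (d n) ((n : ℝ) ^ α))
    (ht : ∀ n : ℕ, IsRounding (t n) (r * (n : ℝ) * Real.log (n : ℝ)))
    (hq : ∀ n : ℕ, IsRounding (q n) (p * (d n : ℝ) ^ k))
    (hp : p < 1 - Real.exp (-(α / r))) :
    Tendsto (fun n : ℕ => prSat n k (d n) (t n) (q n)) atTop (𝓝 1) := by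
  have hk0 : (0 : ℝ) < k := by positivity
  have hα0 : 0 < α := lt_trans (by positivity) hα
  have hp1 : p ≤ 1 := by linarith [Real.exp_pos (-(α / r))]
  -- A fixed `w` eventually below the compatible fraction, so one `c` serves all large `n`; `w >
  -- e^(-α/r)` gives both `1 + c ≤ k` and `r log (1 + c) < α`.
  obtain ⟨w, hw1, hw2⟩ := exists_between (show Real.exp (-(α / r)) < 1 - p by linarith)
  have hw0 : 0 < w := (Real.exp_pos _).trans hw1
  set c : ℝ := w⁻¹ - 1 with hcdef
  have h1c : 1 + c = w⁻¹ := by rw [hcdef]; ring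
  have hc : 0 < c := by
    have : 1 < w⁻¹ := (one_lt_inv₀ hw0).2 (by linarith)
    linarith
  have hck : 1 + c ≤ k := by
    rw [h1c, inv_le_iff_one_le_mul₀ hw0]
    exact hkr.trans (by gcongr)
  have hlog : 0 < Real.log (1 + c) := Real.log_pos (by linarith)
  have hrlog : r < α / Real.log (1 + c) := by
    rw [lt_div_iff₀ hlog, h1c, Real.log_inv]
    have := (Real.lt_log_iff_exp_lt hw0).2 hw1
    have e : α = r * (α / r) := by field_simp
    nlinarith
  obtain ⟨r', hr', hr'2⟩ := exists_between hrlog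
  have hr'0 : 0 < r' := hr.trans hr'
  obtain ⟨β, hβ, hβ2⟩ := exists_between (show 1 / (k : ℝ) < min α 1 from lt_min hα (by
    rw [div_lt_one hk0]; exact_mod_cast hk))
  have hβα := hβ2.trans_le (min_le_left _ _)
  have hβ1 := hβ2.trans_le (min_le_right _ _)
  have hkβ : 1 < k * β := by rwa [div_lt_iff₀' hk0] at hβ
  set δ : ℝ := α - r' * Real.log (1 + c) with hδdef
  have hδ : 0 < δ := by rw [lt_div_iff₀ hlog] at hr'2; linarith
  set ε : ℝ := (α - β) / 2 / (c * r') with hεdef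
  have hε : 0 < ε := by have := sub_pos.2 hβα; positivity
  have hcε : c * ε * r' ≤ (α - β) / 2 := by
    have : ε ≤ (α - β) / 2 / (c * r') := le_rfl
    rw [le_div_iff₀ (by positivity)] at this
    linarith
  have hb := tendsto_overlap_bound (k := k) (r := r') (c := c) hβα hβ1 hkβ (mul_pos hδ hε)
  set b : ℕ → ℝ := fun n => Real.exp (c * r' * ((n : ℝ) ^ (1 - k * β) * Real.log n))
      + Real.exp ((n : ℝ) ^ (1 - β) * (2 - (α - β) / 2 * Real.log n))
      + Real.exp (n * (2 - δ * ε * Real.log n)) with hbdef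
  have hbinv : Tendsto (fun n => (b n)⁻¹) atTop (𝓝 1) := by simpa using hb.inv₀ one_ne_zero
  refine tendsto_of_tendsto_of_tendsto_of_le_of_le' hbinv tendsto_const_nhds ?_
    (Eventually.of_forall fun n => prSat_le_one _ _ _ _ _)
  filter_upwards [eventually_ge_atTop k, eventually_rpow_div_two_le hα0 hd,
    eventually_one_le hα0 hd, eventually_le_mul_log hr' ht,
    (tendsto_density (by omega) hα0 hd hq).eventually_lt_const (show p < 1 - w by linarith)]
    with n hn hd2 hd1 htn hqn
  have hn1 : 1 ≤ n := by omega
  have hw : 1 ≤ (1 - (q n : ℝ) / (d n : ℝ) ^ k) * (1 + c) := by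
    rw [h1c, ← div_eq_mul_inv, one_le_div hw0]
    linarith
  have h1 := le_prSat_mul_sum (t := t n) hn1 hn hd1 (le_pow_of_isRounding hp1 (hq n)) hc.le hw
  have h2 := sum_overlap_weight_le (t := t n) hk hn1 hd2 hβα.le hc.le hck hδ.le
    htn hcε (by rw [hδdef]; linarith)
  have h3 := h1.trans (mul_le_mul_of_nonneg_left h2 (prSat_nonneg _ _ _ _ _))
  have hD : 0 < ((d n : ℝ) ^ n) ^ 2 := by
    have : (0 : ℝ) < d n := by exact_mod_cast hd1
    positivity
  have hbn : 0 < b n := by positivity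
  rw [inv_le_iff_one_le_mul₀ hbn]
  refine le_of_mul_le_mul_left ?_ hD
  rw [mul_one]
  exact h3.trans (le_of_eq (mul_left_comm _ _ _))

theorem tendsto_prSat_zero (hk : k ≠ 0) (hα : 0 < α) (hr : 0 < r) (hp1 : p ≤ 1)
    (hd : ∀ n : ℕ, IsRounding (d n) ((n : ℝ) ^ α))
    (ht : ∀ n : ℕ, IsRounding (t n) (r * (n : ℝ) * Real.log (n : ℝ)))
    (hq : ∀ n : ℕ, IsRounding (q n) (p * (d n : ℝ) ^ k))
    (hp : 1 - Real.exp (-(α / r)) < p) :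
    Tendsto (fun n : ℕ => prSat n k (d n) (t n) (q n)) atTop (𝓝 0) := by
  -- The maximum with 0 keeps `log w` meaningful when `p = 1`.
  obtain ⟨w, hw1, hw2⟩ := exists_between (show max (1 - p) 0 < Real.exp (-(α / r)) from
    max_lt (by linarith) (Real.exp_pos _))
  have hw0 : 0 < w := (le_max_right _ _).trans_lt hw1
  have hwp : 1 - p < w := (le_max_left _ _).trans_lt hw1
  set a : ℝ := -Real.log w with ha
  have har : α / r < a := by
    have := (Real.log_lt_iff_lt_exp hw0).2 hw2
    linarith
  have ha0 : 0 < a := (div_pos hα hr).trans har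
  have hγ : 0 < a * r - α := by rw [div_lt_iff₀ hr] at har; linarith
  -- The factor `e^a` pays for rounding `t`, and `log 2` for `d ≤ 2 n^α`.
  have hlim := (tendsto_exp_rpow_mul_sub_log (s := 1) (a := Real.log 2) one_pos hγ).const_mul
    (Real.exp a)
  simp only [Real.rpow_one, mul_zero] at hlim
  refine squeeze_zero' (Eventually.of_forall fun n => prSat_nonneg _ _ _ _ _) ?_ hlim
  filter_upwards [eventually_ge_atTop k, eventually_ge_atTop 1, eventually_le_two_mul_rpow hα hd,
    eventually_one_le hα hd,
    (tendsto_density hk hα hd hq).eventually_const_lt (show 1 - w < p by linarith)]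
    with n hn hn1 hd2 hd1 hqn
  have hn0 : (0 : ℝ) < n := by exact_mod_cast hn1
  have hd0 : (0 : ℝ) < d n := by exact_mod_cast hd1
  have hqle := le_pow_of_isRounding hp1 (hq n)
  have hv : 0 ≤ 1 - (q n : ℝ) / (d n : ℝ) ^ k := by
    rw [sub_nonneg]
    exact div_le_one_of_le₀ (by exact_mod_cast hqle) (by positivity)
  have htn := (abs_lt.1 (ht n)).1
  refine (prSat_le hn hd1 hqle).trans ?_
  have h1 : (d n : ℝ) ^ n ≤ Real.exp (n * (Real.log 2 + α * Real.log n)) := by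
    rw [Real.exp_nat_mul, Real.exp_add, Real.exp_log two_pos, mul_comm α,
      ← Real.rpow_def_of_pos hn0]
    gcongr
  have h2 : (1 - (q n : ℝ) / (d n : ℝ) ^ k) ^ t n ≤ Real.exp (t n * -a) := by
    rw [Real.exp_nat_mul, ha, neg_neg, Real.exp_log hw0]
    exact pow_le_pow_left₀ hv (by linarith) _
  refine (mul_le_mul h1 h2 (by positivity) (Real.exp_pos _).le).trans ?_
  rw [← Real.exp_add, ← Real.exp_add]
  refine Real.exp_le_exp.2 ?_
  nlinarith

end Rounding

end ModelRB

theorem theorem2 (k : ℕ) (hk : 2 ≤ k) (α r : ℝ) (hα : 1 / (k : ℝ) < α) (hr : 0 < r)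
    (hkr : 1 ≤ (k : ℝ) * Real.exp (-(α / r)))
    (p : ℝ) (hp0 : 0 ≤ p) (hp1 : p ≤ 1)
    (d t q : ℕ → ℕ)
    (hd : ∀ n : ℕ, ModelRB.IsRounding (d n) ((n : ℝ) ^ α))
    (ht : ∀ n : ℕ, ModelRB.IsRounding (t n) (r * (n : ℝ) * Real.log (n : ℝ)))
    (hq : ∀ n : ℕ, ModelRB.IsRounding (q n) (p * (d n : ℝ) ^ k)) :
    (p < 1 - Real.exp (-(α / r)) →
      Tendsto (fun n : ℕ => ModelRB.prSat n k (d n) (t n) (q n)) atTop (𝓝 1)) ∧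
    (1 - Real.exp (-(α / r)) < p →
      Tendsto (fun n : ℕ => ModelRB.prSat n k (d n) (t n) (q n)) atTop (𝓝 0)) :=
  ⟨ModelRB.tendsto_prSat_one hk hα hr hkr hp0 hd ht hq,
    ModelRB.tendsto_prSat_zero (by omega) (lt_trans (by positivity) hα) hr hp1 hd ht hq⟩
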